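/- All groups and digraphs are finite, and digraphs have no loops; a digraph is a *graph* if the reverse of each of its arcs is an arc, and *proper* otherwise. For a group $G$ and $S\subseteq G\setminus\{1\}$, the *Cayley digraph* $\mathrm{Cay}(G,S)$ has vertex set $G$ and an arc $(u,v)$ whenever $vu^{-1}\in S$; its *Cayley index* is the index in its automorphism group of the right regular representation of $G$. The complement $\overline{\Gamma}$ has as arcs the pairs of distinct vertices that are not arcs of $\Gamma$. The cartesian product $\Gamma\square\Delta$ has vertex set $V(\Gamma)\times V(\Delta)$, with $((u,v),(u',v'))$ an arc if and only if either $u=u'$ and $(v,v')$ is an arc of $\Delta$, or $v=v'$ and $(u,u')$ is an arc of $\Gamma$. **Corollary 2.5.** Let $\Gamma_1$ be a proper Cayley digraph on a group $G$ with Cayley index $i_1$, and let $\Gamma_2$ be a (weakly) connected Cayley digraph (for instance, a connected Cayley graph) on a group $H$ with Cayley index $i_2$, where $i_1>i_2$. Then for at least one $\Delta\in\{\Gamma_1,\overline{\Gamma_1}\}$, the automorphism group of $\Delta\square\Gamma_2$ is equal to $\mathrm{Aut}(\Gamma_1)\times\mathrm{Aut}(\Gamma_2)$ in its coordinatewise action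 on $G\times H$, and $\Delta\square\Gamma_2$ is a proper Cayley digraph on $G\times H$ with Cayley index $i_1i_2$. -/

import Mathlib

/-- A digraph in the sense used here: a set of arcs, each an ordered pair of distinct vertices
(so there are no loops). -/
structure LooplessDigraph (V : Type*) extends Digraph V where
  loopless : ∀ v, ¬ Adj v v

namespace LooplessDigraph

variable {V W : Type*}

/-- A digraph is a graph if all its arcs can be reversed. -/
def IsGraph (Γ : LooplessDigraph V) : Prop :=
  ∀ u v, Γ.Adj u v → Γ.Adj v u

/-- A digraph is proper if it is not a graph. -/
def IsProper (Γ : LooplessDigraph V) : Prop :=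
  ¬ Γ.IsGraph

/-- The complement: two distinct vertices form an arc iff they did not form one before. -/
def complement (Γ : LooplessDigraph V) : LooplessDigraph V where
  Adj u v := u ≠ v ∧ ¬ Γ.Adj u v
  loopless _ h := h.1 rfl

/-- The cartesian product of two digraphs. -/
def boxProd (Γ : LooplessDigraph V) (Δ : LooplessDigraph W) : LooplessDigraph (V × W) where
  Adj x y := (x.1 = y.1 ∧ Δ.Adj x.2 y.2) ∨ (x.2 = y.2 ∧ Γ.Adj x.1 y.1)
  loopless _ h := h.elim (fun h => Δ.loopless _ h.2) (fun h => Γ.loopless _ h.2)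

/-- A digraph is weakly connected if its underlying simple graph is connected. -/
def IsWeaklyConnected (Γ : LooplessDigraph V) : Prop :=
  (SimpleGraph.fromRel Γ.Adj).Connected

/-- The automorphism group of a digraph, as a group of permutations of the vertices. -/
def aut (Γ : LooplessDigraph V) : Subgroup (Equiv.Perm V) where
  carrier := {σ | ∀ u v, Γ.Adj (σ u) (σ v) ↔ Γ.Adj u v}
  one_mem' _ _ := Iff.rfl
  mul_mem' {σ τ} hσ hτ u v := (hσ (τ u) (τ v)).trans (hτ u v)
  inv_mem' {σ} hσ u v := by
    have h := hσ (σ⁻¹ u) (σ⁻¹ v)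
    change Γ.Adj (σ (σ.symm u)) (σ (σ.symm v)) ↔ _ at h
    rw [Equiv.apply_symm_apply, Equiv.apply_symm_apply] at h
    exact h.symm

/-- The Cayley digraph on the group `G` with connection set `S`, where `S` does not contain the
identity: `(u, v)` is an arc iff `v * u⁻¹ ∈ S`. -/
def cayley {G : Type*} [Group G] (S : Set G) (hS : (1 : G) ∉ S) : LooplessDigraph G where
  Adj u v := v * u⁻¹ ∈ S
  loopless v h := hS (by rwa [mul_inv_cancel] at h)

/-- A digraph with vertex set `G` is a Cayley digraph on `G` if it is the Cayley digraph of some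
connection set. -/
def IsCayley {G : Type*} [Group G] (Γ : LooplessDigraph G) : Prop :=
  ∃ (S : Set G) (hS : (1 : G) ∉ S), Γ = cayley S hS

end LooplessDigraph

/-- The right regular representation of `G`, i.e. the group of all permutations `x ↦ x * g`
of `G`. -/
def rightRegular (G : Type*) [Group G] : Subgroup (Equiv.Perm G) :=
  (MulAction.toPermHom Gᵐᵒᵖ G).range

/-- The Cayley index of a Cayley digraph on `G`: the index in its automorphism group of `G`, the
latter being identified with its right regular representation. -/
noncomputable def LooplessDigraph.cayleyIndex {G : Type*} [Group G] (Γ : LooplessDigraph G) : ℕ :=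
  (rightRegular G).relIndex Γ.aut

/-- The direct product of two permutation groups in its coordinatewise action on `V × W`. -/
def permGroupProd {V W : Type*} (A : Subgroup (Equiv.Perm V)) (B : Subgroup (Equiv.Perm W)) :
    Subgroup (Equiv.Perm (V × W)) where
  carrier := {σ | ∃ a ∈ A, ∃ b ∈ B, ∀ v w, σ (v, w) = (a v, b w)}
  one_mem' := ⟨1, A.one_mem, 1, B.one_mem, fun _ _ => rfl⟩
  mul_mem' := by
    rintro σ τ ⟨a, ha, b, hb, h⟩ ⟨a', ha', b', hb', h'⟩
    exact ⟨a * a', A.mul_mem ha ha', b * b', B.mul_mem hb hb', fun v w => by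
      simp [Equiv.Perm.mul_apply, h, h']⟩
  inv_mem' := by
    rintro σ ⟨a, ha, b, hb, h⟩
    exact ⟨a⁻¹, A.inv_mem ha, b⁻¹, B.inv_mem hb, fun v w => by
      rw [Equiv.Perm.inv_eq_iff_eq, h]; simp⟩

/-!
Properness provides a pair `x`, `y` joined in one direction only. Such a pair is joined both in `Γ`
and in its complement, and translating it along one factor of a nontrivial factorization of `Γ`
gives enough squares and triangles in the complement to force the complement to be connected and
indecomposable. Hence `Γ₁` or its complement, call it `Δ`, is connected and indecomposable.

Layers of a product of connected digraphs are geodesically convex, so an automorphism of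
`Δ □ Γ₂` pulls the product structure back to a factorization of each layer of `Δ`, which must be
trivial: the layer is sent either into a layer of `Δ` or into a layer of `Γ₂`. The latter would
embed vertex stabilizers of `Aut Δ`, of order `i₁`, into vertex stabilizers of `Aut Γ₂`, of order
`i₂ < i₁`. So layers of `Δ` are permuted, and by connectedness of `Γ₂` so are those of `Γ₂`.
-/

namespace LooplessDigraph

section Factorization

variable {V : Type*} {Γ : LooplessDigraph V} {r s : Setoid V} {x y z : V}

/-- The pair `(x, y)` is an arc whose reverse is not an arc. -/
def OneWay (Γ : LooplessDigraph V) (x y : V) : Prop :=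
  Γ.Adj x y ∧ ¬ Γ.Adj y x

/-- A cartesian factorization of `Γ`, encoded on the vertex set of `Γ` itself: the classes of `r`
and of `s` are the layers of the two factors, i.e. the fibres of the two coordinate projections. -/
structure IsFactorization (Γ : LooplessDigraph V) (r s : Setoid V) : Prop where
  eq_of_rel : ∀ {x y}, r x y → s x y → x = y
  exists_corner : ∀ x y, ∃ z, r x z ∧ s z y
  rel_of_adj : ∀ {x y}, Γ.Adj x y → r x y ∨ s x y
  adj_iff_left : ∀ {x y x' y'}, r x x' → r y y' → s x y → s x' y' → (Γ.Adj x y ↔ Γ.Adj x' y')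
  adj_iff_right : ∀ {x y x' y'}, s x x' → s y y' → r x y → r x' y' → (Γ.Adj x y ↔ Γ.Adj x' y')

/-- A digraph is indecomposable if each of its cartesian factorizations has a factor with at most
one vertex. A digraph with at most one vertex counts as indecomposable. -/
def IsIndecomposable (Γ : LooplessDigraph V) : Prop :=
  ∀ r s : Setoid V, Γ.IsFactorization r s → r = ⊤ ∨ s = ⊤

theorem ne_of_adj (h : Γ.Adj x y) : x ≠ y := by
  rintro rfl
  exact Γ.loopless _ h

theorem complement_complement (Γ : LooplessDigraph V) : Γ.complement.complement = Γ := by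
  obtain ⟨⟨Adj⟩, hloop⟩ := Γ
  simp only [complement, mk.injEq, Digraph.mk.injEq]
  ext u v
  have hne : Adj u v → u ≠ v := by
    rintro h rfl
    exact hloop _ h
  tauto

theorem isProper_iff_exists_oneWay : Γ.IsProper ↔ ∃ x y, Γ.OneWay x y := by
  simp only [IsProper, IsGraph, OneWay, not_forall, exists_prop]

theorem OneWay.ne (h : Γ.OneWay x y) : x ≠ y :=
  ne_of_adj h.1

theorem OneWay.complement (h : Γ.OneWay x y) : Γ.complement.OneWay y x :=
  ⟨⟨h.ne.symm, h.2⟩, fun hc => hc.2 h.1⟩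

theorem IsProper.complement (h : Γ.IsProper) : Γ.complement.IsProper := by
  obtain ⟨x, y, hxy⟩ := isProper_iff_exists_oneWay.1 h
  exact isProper_iff_exists_oneWay.2 ⟨y, x, hxy.complement⟩

theorem reachable_of_adj (h : Γ.Adj x y) : (SimpleGraph.fromRel Γ.Adj).Reachable x y :=
  SimpleGraph.Adj.reachable ((SimpleGraph.fromRel_adj _ _ _).2 ⟨ne_of_adj h, Or.inl h⟩)

theorem complement_isWeaklyConnected_of_not [Nonempty V] (h : ¬ Γ.IsWeaklyConnected) :
    Γ.complement.IsWeaklyConnected := by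
  have hle : (SimpleGraph.fromRel Γ.Adj)ᶜ ≤ SimpleGraph.fromRel Γ.complement.Adj := by
    intro u v huv
    rw [SimpleGraph.compl_adj, SimpleGraph.fromRel_adj] at huv
    exact (SimpleGraph.fromRel_adj _ _ _).2
      ⟨huv.1, Or.inl ⟨huv.1, fun hadj => huv.2 ⟨huv.1, Or.inl hadj⟩⟩⟩
  exact ((SimpleGraph.fromRel Γ.Adj).connected_or_connected_compl.resolve_left h).mono hle

namespace IsFactorization

theorem swap (h : Γ.IsFactorization r s) : Γ.IsFactorization s r where
  eq_of_rel hs hr := h.eq_of_rel hr hs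
  exists_corner x y := by
    obtain ⟨z, hyz, hzx⟩ := h.exists_corner y x
    exact ⟨z, s.symm hzx, r.symm hyz⟩
  rel_of_adj hadj := (h.rel_of_adj hadj).symm
  adj_iff_left := h.adj_iff_right
  adj_iff_right := h.adj_iff_left

theorem oneWay_of_parallel {x' y' : V} (h : Γ.IsFactorization r s) (hxy : Γ.OneWay x y)
    (hx : r x x') (hy : r y y') (hs : s x y) (hs' : s x' y') : Γ.OneWay x' y' :=
  ⟨(h.adj_iff_left hx hy hs hs').1 hxy.1,
    fun hadj => hxy.2 ((h.adj_iff_left hy hx (s.symm hs) (s.symm hs')).2 hadj)⟩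

theorem complement_adj (h : Γ.IsFactorization r s) (hr : ¬ r x y) (hs : ¬ s x y) :
    Γ.complement.Adj x y :=
  ⟨fun hxy => hr (hxy ▸ r.refl x), fun hadj => (h.rel_of_adj hadj).elim hr hs⟩

theorem rel_of_triangle (h : Γ.IsFactorization r s) (hne : x ≠ y) (hxy : s x y)
    (hxz : r x z ∨ s x z) (hyz : r y z ∨ s y z) : s x z := by
  rcases hxz with hxz | hxz
  · rcases hyz with hyz | hyz
    · exact absurd (h.eq_of_rel (r.trans hxz (r.symm hyz)) hxy) hne
    · exact s.trans hxy hyz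
  · exact hxz

/-- Opposite sides of a square spanned by both factors are oriented in parallel, so a square
`x → y - w → w' - x` whose side `x → y` is one-way cannot involve both factors. -/
theorem rel_of_cyclic_square {w w' : V} (h : Γ.IsFactorization r s) (hxy : Γ.OneWay x y)
    (hs : s x y) (hyw : r y w ∨ s y w) (hww' : Γ.Adj w w') (hw'x : r w' x ∨ s w' x)
    (hne : y ≠ w') : s x w := by
  rcases hyw with hyw | hyw
  · rcases h.rel_of_adj hww' with hr | hs'
    · have hyw' : r y w' := r.trans hyw hr
      rcases hw'x with hw'x | hw'x
      · exact absurd (h.eq_of_rel (r.symm (r.trans hyw' hw'x)) hs) hxy.ne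
      · exact absurd (h.eq_of_rel hyw' (s.symm (s.trans hw'x hs))) hne
    · rcases hw'x with hw'x | hw'x
      · exact absurd ((h.adj_iff_left hyw (r.symm hw'x) (s.symm hs) hs').2 hww') hxy.2
      · exact s.symm (s.trans hs' hw'x)
  · exact s.trans hs hyw

/-- If a one-way pair of `s`-related vertices is always `t`-related to everything outside its
`s`-class, then two parallel one-way pairs together reach every vertex. -/
theorem eq_top_of_oneWay (h : Γ.IsFactorization r s) (hs : s ≠ ⊤) {t : Setoid V}
    (hxy : Γ.OneWay x y) (hsxy : s x y) (htxy : t x y)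
    (ht : ∀ {x y z}, Γ.OneWay x y → s x y → t x y → ¬ s x z → t x z) : t = ⊤ := by
  obtain ⟨z, hxz⟩ : ∃ z, ¬ s x z := by
    by_contra! hx
    exact hs (Setoid.eq_top_iff.2 fun u v => s.trans (s.symm (hx u)) (hx v))
  obtain ⟨x', hxx', hx'z⟩ := h.exists_corner x z
  obtain ⟨y', hyy', hy'x'⟩ := h.exists_corner y x'
  have hsx' : ¬ s x x' := fun hx' => hxz (s.trans hx' hx'z)
  have hsy' : ¬ s x y' := fun hy' => hsx' (s.trans hy' hy'x')
  have htx' : t x x' := ht hxy hsxy htxy hsx'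
  have htx'y' : t x' y' := t.trans (t.symm htx') (ht hxy hsxy htxy hsy')
  have hx'y' : Γ.OneWay x' y' := h.oneWay_of_parallel hxy hxx' hyy' hsxy (s.symm hy'x')
  have htx : ∀ u, t x u := by
    intro u
    by_cases hxu : s x u
    · exact t.trans htx' <| ht hx'y' (s.symm hy'x') htx'y'
        fun hx'u => hsx' (s.trans hxu (s.symm hx'u))
    · exact ht hxy hsxy htxy hxu
  exact Setoid.eq_top_iff.2 fun u v => t.trans (t.symm (htx u)) (htx v)

theorem complement_isWeaklyConnected (h : Γ.IsFactorization r s) (hs : s ≠ ⊤)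
    (hxy : Γ.OneWay x y) (hsxy : s x y) : Γ.complement.IsWeaklyConnected := by
  have hreach : (SimpleGraph.fromRel Γ.complement.Adj).reachableSetoid = ⊤ := by
    refine h.eq_top_of_oneWay hs hxy hsxy (reachable_of_adj hxy.complement.1).symm ?_
    intro x y z hxy hsxy hreach hxz
    by_cases hrxz : r x z
    · have hryz : ¬ r y z := fun hryz =>
        hxy.ne (h.eq_of_rel (r.trans hrxz (r.symm hryz)) hsxy)
      have hsyz : ¬ s y z := fun hsyz => hxz (s.trans hsxy hsyz)
      exact hreach.trans (reachable_of_adj (h.complement_adj hryz hsyz))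
    · exact reachable_of_adj (h.complement_adj hrxz hxz)
  exact (SimpleGraph.connected_iff _).2 ⟨Setoid.eq_top_iff.1 hreach, ⟨x⟩⟩

section Complement

variable {r' s' : Setoid V}

theorem rel_of_parallel_of_complement {w w' : V} (h : Γ.IsFactorization r s)
    (h' : Γ.complement.IsFactorization r' s') (hxy : Γ.OneWay x y) (hsxy : s x y)
    (hsxy' : s' x y) (hxw : r x w) (hyw' : r y w') (hww' : s w w') (hsxw : ¬ s x w) :
    s' x w ∧ s' x w' := by
  have hrxy : ¬ r x y := fun hrxy => hxy.ne (h.eq_of_rel hrxy hsxy)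
  have hyw : Γ.complement.Adj y w := h.complement_adj
    (fun hyw => hrxy (r.trans hxw (r.symm hyw))) fun hyw => hsxw (s.trans hsxy hyw)
  have hxw'_adj : Γ.complement.Adj x w' := h.complement_adj
    (fun hxw' => hrxy (r.trans hxw' (r.symm hyw'))) fun hxw' => hsxw (s.trans hxw' (s.symm hww'))
  have hw'w : Γ.complement.Adj w' w :=
    (h.oneWay_of_parallel hxy hxw hyw' hsxy hww').complement.1
  have hsyw' : s' y w' := h'.rel_of_cyclic_square hxy.complement (s'.symm hsxy')
    (h'.rel_of_adj hxw'_adj) hw'w ((h'.rel_of_adj hyw).imp r'.symm s'.symm)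
    fun hxw => hsxw (hxw ▸ s.refl x)
  have hne : y ≠ w' := fun hyw' => hsxw (s.trans (hyw' ▸ hsxy) (s.symm hww'))
  have hsyw : s' y w :=
    h'.rel_of_triangle hne hsyw' (h'.rel_of_adj hyw) (h'.rel_of_adj hw'w)
  exact ⟨s'.trans hsxy' hsyw, s'.trans hsxy' hsyw'⟩

theorem rel_of_not_rel_of_complement (h : Γ.IsFactorization r s)
    (h' : Γ.complement.IsFactorization r' s') (hxy : Γ.OneWay x y) (hsxy : s x y)
    (hsxy' : s' x y) (hxz : ¬ s x z) : s' x z := by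
  by_cases hrxz : r x z
  · obtain ⟨w', hyw', hw'z⟩ := h.exists_corner y z
    exact (h.rel_of_parallel_of_complement h' hxy hsxy hsxy' hrxz hyw' (s.symm hw'z) hxz).1
  by_cases hryz : r y z
  · obtain ⟨w, hxw, hwz⟩ := h.exists_corner x z
    exact (h.rel_of_parallel_of_complement h' hxy hsxy hsxy' hxw hryz hwz
      fun hsxw => hxz (s.trans hsxw hwz)).2
  have hsyz : ¬ s y z := fun hsyz => hxz (s.trans hsxy hsyz)
  exact h'.rel_of_triangle hxy.ne hsxy' (h'.rel_of_adj (h.complement_adj hrxz hxz))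
    (h'.rel_of_adj (h.complement_adj hryz hsyz))

theorem complement_isIndecomposable (h : Γ.IsFactorization r s) (hs : s ≠ ⊤)
    (hxy : Γ.OneWay x y) (hsxy : s x y) : Γ.complement.IsIndecomposable := by
  intro r' s' h'
  rcases h'.rel_of_adj hxy.complement.1 with hyx | hyx
  · exact Or.inl <| h.eq_top_of_oneWay hs hxy hsxy (r'.symm hyx)
      (h.rel_of_not_rel_of_complement h'.swap)
  · exact Or.inr <| h.eq_top_of_oneWay hs hxy hsxy (s'.symm hyx)
      (h.rel_of_not_rel_of_complement h')

end Complement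

end IsFactorization

theorem IsProper.exists_isFactorization_oneWay (hp : Γ.IsProper) (hi : ¬ Γ.IsIndecomposable) :
    ∃ r s, Γ.IsFactorization r s ∧ s ≠ ⊤ ∧ ∃ x y, Γ.OneWay x y ∧ s x y := by
  simp only [IsIndecomposable, not_forall, not_or] at hi
  obtain ⟨r, s, h, hr, hs⟩ := hi
  obtain ⟨x, y, hxy⟩ := isProper_iff_exists_oneWay.1 hp
  rcases h.rel_of_adj hxy.1 with hrxy | hsxy
  · exact ⟨s, r, h.swap, hr, x, y, hxy, hrxy⟩
  · exact ⟨r, s, h, hs, x, y, hxy, hsxy⟩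

theorem IsProper.complement_isWeaklyConnected (hp : Γ.IsProper) (hi : ¬ Γ.IsIndecomposable) :
    Γ.complement.IsWeaklyConnected := by
  obtain ⟨r, s, h, hs, x, y, hxy, hsxy⟩ := hp.exists_isFactorization_oneWay hi
  exact h.complement_isWeaklyConnected hs hxy hsxy

theorem IsProper.complement_isIndecomposable (hp : Γ.IsProper) (hi : ¬ Γ.IsIndecomposable) :
    Γ.complement.IsIndecomposable := by
  obtain ⟨r, s, h, hs, x, y, hxy, hsxy⟩ := hp.exists_isFactorization_oneWay hi
  exact h.complement_isIndecomposable hs hxy hsxy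

theorem IsProper.exists_isWeaklyConnected_isIndecomposable [Nonempty V] (hp : Γ.IsProper) :
    ∃ Δ : LooplessDigraph V, (Δ = Γ ∨ Δ = Γ.complement) ∧
      Δ.IsWeaklyConnected ∧ Δ.IsIndecomposable := by
  by_cases hi : Γ.IsIndecomposable
  · by_cases hc : Γ.IsWeaklyConnected
    · exact ⟨Γ, Or.inl rfl, hc, hi⟩
    · have hi' : Γ.complement.IsIndecomposable := by
        by_contra hi'
        exact hc (Γ.complement_complement ▸ hp.complement.complement_isWeaklyConnected hi')
      exact ⟨_, Or.inr rfl, complement_isWeaklyConnected_of_not hc, hi'⟩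
  · exact ⟨_, Or.inr rfl, hp.complement_isWeaklyConnected hi, hp.complement_isIndecomposable hi⟩

end Factorization

end LooplessDigraph

section PermGroupProd

variable {V W : Type*}

/-- The coordinatewise action of a pair of permutations, as a homomorphism; `permGroupProd A B` is
the image of `A.prod B` under it. -/
def permProdHom (V W : Type*) : Equiv.Perm V × Equiv.Perm W →* Equiv.Perm (V × W) where
  toFun σ := Equiv.prodCongr σ.1 σ.2
  map_one' := rfl
  map_mul' _ _ := rfl

theorem permProdHom_apply (a : Equiv.Perm V) (b : Equiv.Perm W) (p : V × W) :
    permProdHom V W (a, b) p = (a p.1, b p.2) :=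
  rfl

theorem permProdHom_injective [Nonempty V] [Nonempty W] :
    Function.Injective (permProdHom V W) := by
  rintro ⟨a, b⟩ ⟨a', b'⟩ h
  have hp (p : V × W) : (a p.1, b p.2) = (a' p.1, b' p.2) := DFunLike.congr_fun h p
  obtain ⟨v⟩ := ‹Nonempty V›
  obtain ⟨w⟩ := ‹Nonempty W›
  exact Prod.ext (Equiv.ext fun u => congrArg Prod.fst (hp (u, w)))
    (Equiv.ext fun u => congrArg Prod.snd (hp (v, u)))

theorem permGroupProd_eq_map (A : Subgroup (Equiv.Perm V)) (B : Subgroup (Equiv.Perm W)) :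
    permGroupProd A B = (A.prod B).map (permProdHom V W) := by
  ext σ
  constructor
  · rintro ⟨a, ha, b, hb, h⟩
    exact ⟨(a, b), ⟨ha, hb⟩, Equiv.ext fun p => (h p.1 p.2).symm⟩
  · rintro ⟨⟨a, b⟩, ⟨ha, hb⟩, rfl⟩
    exact ⟨a, ha, b, hb, fun _ _ => rfl⟩

theorem permGroupProd_mono {A A' : Subgroup (Equiv.Perm V)} {B B' : Subgroup (Equiv.Perm W)}
    (hA : A ≤ A') (hB : B ≤ B') : permGroupProd A B ≤ permGroupProd A' B' := by
  simp only [permGroupProd_eq_map]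
  exact Subgroup.map_mono (Subgroup.prod_mono hA hB)

theorem relIndex_prod {G H : Type*} [Group G] [Group H] (A C : Subgroup G) (B D : Subgroup H) :
    (A.prod B).relIndex (C.prod D) = A.relIndex C * B.relIndex D := by
  have hrange : (C.subtype.prodMap D.subtype).range = C.prod D := by
    rw [MonoidHom.range_prodMap, C.range_subtype, D.range_subtype]
  rw [← hrange, ← Subgroup.index_comap]
  exact Subgroup.index_prod (A.subgroupOf C) (B.subgroupOf D)

theorem relIndex_permGroupProd [Nonempty V] [Nonempty W] (A C : Subgroup (Equiv.Perm V))
    (B D : Subgroup (Equiv.Perm W)) :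
    (permGroupProd A B).relIndex (permGroupProd C D) = A.relIndex C * B.relIndex D := by
  rw [permGroupProd_eq_map, permGroupProd_eq_map,
    Subgroup.relIndex_map_map_of_injective _ _ permProdHom_injective, relIndex_prod]

theorem exists_perm_semiconj {X Y : Type*} {f : X → Y} (hf : Function.Surjective f)
    {σ : Equiv.Perm X} (hσ : ∀ p q, f (σ p) = f (σ q) ↔ f p = f q) :
    ∃ a : Equiv.Perm Y, ∀ p, f (σ p) = a (f p) := by
  let g : Y → Y := fun y => f (σ (Function.surjInv hf y))
  have hg : ∀ p, f (σ p) = g (f p) := fun p => (hσ _ _).2 (Function.surjInv_eq hf _).symm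
  have hinj : Function.Injective g := fun y y' h => by
    simpa only [Function.surjInv_eq hf] using (hσ _ _).1 h
  have hsurj : Function.Surjective g := fun y =>
    ⟨f (σ.symm (Function.surjInv hf y)), by
      rw [← hg, Equiv.apply_symm_apply, Function.surjInv_eq hf]⟩
  exact ⟨Equiv.ofBijective g ⟨hinj, hsurj⟩, hg⟩

end PermGroupProd

namespace LooplessDigraph

section BoxProd

variable {V W : Type*} {Γ : LooplessDigraph V} {Δ : LooplessDigraph W}

theorem mem_aut {σ : Equiv.Perm V} :
    σ ∈ Γ.aut ↔ ∀ u v, Γ.Adj (σ u) (σ v) ↔ Γ.Adj u v :=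
  Iff.rfl

theorem aut_le_aut_complement (Γ : LooplessDigraph V) : Γ.aut ≤ Γ.complement.aut := fun σ hσ u v =>
  and_congr σ.injective.ne_iff (not_congr (hσ u v))

theorem aut_complement (Γ : LooplessDigraph V) : Γ.complement.aut = Γ.aut := by
  refine le_antisymm ?_ Γ.aut_le_aut_complement
  simpa only [complement_complement] using Γ.complement.aut_le_aut_complement

theorem boxProd_adj {p q : V × W} :
    (Γ.boxProd Δ).Adj p q ↔ (p.1 = q.1 ∧ Δ.Adj p.2 q.2) ∨ (p.2 = q.2 ∧ Γ.Adj p.1 q.1) :=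
  Iff.rfl

theorem boxProd_adj_of_fst_eq {p q : V × W} (h : p.1 = q.1) :
    (Γ.boxProd Δ).Adj p q ↔ Δ.Adj p.2 q.2 := by
  simp [boxProd_adj, h, Γ.loopless]

theorem boxProd_adj_of_snd_eq {p q : V × W} (h : p.2 = q.2) :
    (Γ.boxProd Δ).Adj p q ↔ Γ.Adj p.1 q.1 := by
  simp [boxProd_adj, h, Δ.loopless]

theorem boxProd_adj_mk_left {v : V} {x y : W} :
    (Γ.boxProd Δ).Adj (v, x) (v, y) ↔ Δ.Adj x y :=
  boxProd_adj_of_fst_eq (p := (v, x)) (q := (v, y)) rfl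

theorem boxProd_adj_mk_right {u v : V} {w : W} :
    (Γ.boxProd Δ).Adj (u, w) (v, w) ↔ Γ.Adj u v :=
  boxProd_adj_of_snd_eq (p := (u, w)) (q := (v, w)) rfl

theorem IsProper.boxProd [Nonempty W] (hp : Γ.IsProper) (Δ : LooplessDigraph W) :
    (Γ.boxProd Δ).IsProper := by
  obtain ⟨u, v, huv, hvu⟩ := isProper_iff_exists_oneWay.1 hp
  obtain ⟨w⟩ := ‹Nonempty W›
  exact isProper_iff_exists_oneWay.2 ⟨(u, w), (v, w), boxProd_adj_mk_right.2 huv,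
    mt boxProd_adj_mk_right.1 hvu⟩

theorem permProdHom_mem_aut {a : Equiv.Perm V} {b : Equiv.Perm W} (ha : a ∈ Γ.aut)
    (hb : b ∈ Δ.aut) : permProdHom V W (a, b) ∈ (Γ.boxProd Δ).aut := fun p q => by
  simp only [permProdHom_apply, boxProd_adj, EmbeddingLike.apply_eq_iff_eq, mem_aut.1 ha,
    mem_aut.1 hb]

theorem permGroupProd_aut_le (Γ : LooplessDigraph V) (Δ : LooplessDigraph W) :
    permGroupProd Γ.aut Δ.aut ≤ (Γ.boxProd Δ).aut := by
  rw [permGroupProd_eq_map, Subgroup.map_le_iff_le_comap]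
  exact fun _ h => permProdHom_mem_aut h.1 h.2

theorem mem_permGroupProd_of_mem_aut [Nonempty V] [Nonempty W] {σ : Equiv.Perm (V × W)}
    (hσ : σ ∈ (Γ.boxProd Δ).aut) (hfst : ∀ p q, (σ p).1 = (σ q).1 ↔ p.1 = q.1)
    (hsnd : ∀ p q, (σ p).2 = (σ q).2 ↔ p.2 = q.2) : σ ∈ permGroupProd Γ.aut Δ.aut := by
  obtain ⟨a, ha⟩ := exists_perm_semiconj Prod.fst_surjective hfst
  obtain ⟨b, hb⟩ := exists_perm_semiconj Prod.snd_surjective hsnd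
  obtain ⟨v⟩ := ‹Nonempty V›
  obtain ⟨w⟩ := ‹Nonempty W›
  refine ⟨a, fun u u' => ?_, b, fun u u' => ?_, fun u x => Prod.ext (ha _) (hb _)⟩
  · have h := hσ (u, w) (u', w)
    rwa [boxProd_adj_mk_right, boxProd_adj_of_snd_eq ((hsnd (u, w) (u', w)).2 rfl), ha, ha] at h
  · have h := hσ (v, u) (v, u')
    rwa [boxProd_adj_mk_left, boxProd_adj_of_fst_eq ((hfst (v, u) (v, u')).2 rfl), hb, hb] at h

end BoxProd

section Geodesics

variable {V W : Type*} {Γ : LooplessDigraph V} {Δ : LooplessDigraph W}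

/-- The distance in the underlying simple graph, where arcs may be traversed in both directions. It
is `0` for vertices in different weak components. -/
noncomputable def dist (Γ : LooplessDigraph V) (x y : V) : ℕ :=
  (SimpleGraph.fromRel Γ.Adj).dist x y

/-- The vertex `z` lies on a geodesic from `x` to `y` in the underlying simple graph. -/
def IsBetween (Γ : LooplessDigraph V) (x z y : V) : Prop :=
  Γ.dist x z + Γ.dist z y = Γ.dist x y

theorem fromRel_boxProd (Γ : LooplessDigraph V) (Δ : LooplessDigraph W) :
    SimpleGraph.fromRel (Γ.boxProd Δ).Adj =
      (SimpleGraph.fromRel Γ.Adj).boxProd (SimpleGraph.fromRel Δ.Adj) := by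
  ext p q
  simp only [SimpleGraph.fromRel_adj, SimpleGraph.boxProd_adj, boxProd_adj, Ne, Prod.ext_iff]
  grind [Γ.loopless, Δ.loopless]

theorem IsWeaklyConnected.boxProd (hΓ : Γ.IsWeaklyConnected) (hΔ : Δ.IsWeaklyConnected) :
    (Γ.boxProd Δ).IsWeaklyConnected := by
  rw [IsWeaklyConnected, fromRel_boxProd]
  exact SimpleGraph.Connected.boxProd hΓ hΔ

theorem dist_boxProd (hΓ : Γ.IsWeaklyConnected) (hΔ : Δ.IsWeaklyConnected) (p q : V × W) :
    (Γ.boxProd Δ).dist p q = Γ.dist p.1 q.1 + Δ.dist p.2 q.2 := by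
  have hreach := (hΓ.boxProd hΔ).preconnected p q
  have h := SimpleGraph.edist_boxProd (G := SimpleGraph.fromRel Γ.Adj)
    (H := SimpleGraph.fromRel Δ.Adj) p q
  rw [← fromRel_boxProd, ← hreach.coe_dist_eq_edist, ← (hΓ.preconnected _ _).coe_dist_eq_edist,
    ← (hΔ.preconnected _ _).coe_dist_eq_edist] at h
  exact_mod_cast h

theorem dist_apply_le (hΓ : Γ.IsWeaklyConnected) {σ : Equiv.Perm V} (hσ : σ ∈ Γ.aut) (x y : V) :
    Γ.dist (σ x) (σ y) ≤ Γ.dist x y := by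
  let f : SimpleGraph.fromRel Γ.Adj →g SimpleGraph.fromRel Γ.Adj :=
    ⟨σ, by simp only [SimpleGraph.fromRel_adj, mem_aut.1 hσ, σ.injective.ne_iff, imp_self,
      implies_true]⟩
  obtain ⟨p, hp⟩ := SimpleGraph.Connected.exists_walk_length_eq_dist hΓ x y
  calc Γ.dist (σ x) (σ y) ≤ (p.map f).length := SimpleGraph.dist_le _
    _ = Γ.dist x y := (p.length_map f).trans hp

theorem dist_apply (hΓ : Γ.IsWeaklyConnected) {σ : Equiv.Perm V} (hσ : σ ∈ Γ.aut) (x y : V) :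
    Γ.dist (σ x) (σ y) = Γ.dist x y := by
  refine le_antisymm (dist_apply_le hΓ hσ x y) ?_
  simpa using dist_apply_le hΓ (inv_mem hσ) (σ x) (σ y)

theorem IsBetween.apply {x y z : V} (h : Γ.IsBetween x z y) (hΓ : Γ.IsWeaklyConnected)
    {σ : Equiv.Perm V} (hσ : σ ∈ Γ.aut) : Γ.IsBetween (σ x) (σ z) (σ y) := by
  simpa only [IsBetween, dist_apply hΓ hσ] using h

theorem isBetween_left (Γ : LooplessDigraph V) (x y : V) : Γ.IsBetween x x y := by
  simp [IsBetween, dist]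

theorem isBetween_right (Γ : LooplessDigraph V) (x y : V) : Γ.IsBetween x y y := by
  simp [IsBetween, dist]

theorem IsBetween.eq_of_self {x z : V} (h : Γ.IsBetween x z x) (hΓ : Γ.IsWeaklyConnected) :
    z = x := by
  have hxx : Γ.dist x x = 0 := SimpleGraph.dist_self
  rw [IsBetween, hxx, Nat.add_eq_zero_iff] at h
  exact (SimpleGraph.Connected.dist_eq_zero_iff hΓ).1 h.2

theorem isBetween_boxProd (hΓ : Γ.IsWeaklyConnected) (hΔ : Δ.IsWeaklyConnected)
    {p q m : V × W} :
    (Γ.boxProd Δ).IsBetween p m q ↔ Γ.IsBetween p.1 m.1 q.1 ∧ Δ.IsBetween p.2 m.2 q.2 := by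
  simp only [IsBetween, dist_boxProd hΓ hΔ]
  have hV : Γ.dist p.1 q.1 ≤ Γ.dist p.1 m.1 + Γ.dist m.1 q.1 :=
    SimpleGraph.Connected.dist_triangle hΓ
  have hW : Δ.dist p.2 q.2 ≤ Δ.dist p.2 m.2 + Δ.dist m.2 q.2 :=
    SimpleGraph.Connected.dist_triangle hΔ
  omega

theorem IsBetween.fst_eq {p q m : V × W} (h : (Γ.boxProd Δ).IsBetween p m q)
    (hΓ : Γ.IsWeaklyConnected) (hΔ : Δ.IsWeaklyConnected) (hpq : p.1 = q.1) : m.1 = q.1 := by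
  have hfst := ((isBetween_boxProd hΓ hΔ).1 h).1
  rw [hpq] at hfst
  exact hfst.eq_of_self hΓ

theorem IsBetween.snd_eq {p q m : V × W} (h : (Γ.boxProd Δ).IsBetween p m q)
    (hΓ : Γ.IsWeaklyConnected) (hΔ : Δ.IsWeaklyConnected) (hpq : p.2 = q.2) : m.2 = q.2 := by
  have hsnd := ((isBetween_boxProd hΓ hΔ).1 h).2
  rw [hpq] at hsnd
  exact hsnd.eq_of_self hΔ

end Geodesics

section AutBoxProd

variable {V W : Type*} {Γ : LooplessDigraph V} {Δ : LooplessDigraph W} {σ : Equiv.Perm (V × W)}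

theorem exists_corner_of_mem_aut (hΓ : Γ.IsWeaklyConnected) (hΔ : Δ.IsWeaklyConnected)
    (hσ : σ ∈ (Γ.boxProd Δ).aut) (w : W) (x y : V) :
    ∃ z, (σ (z, w)).1 = (σ (x, w)).1 ∧ (σ (z, w)).2 = (σ (y, w)).2 := by
  set corner : V × W := ((σ (x, w)).1, (σ (y, w)).2)
  have hcorner : (Γ.boxProd Δ).IsBetween (σ (x, w)) corner (σ (y, w)) :=
    (isBetween_boxProd hΓ hΔ).2 ⟨isBetween_left _ _ _, isBetween_right _ _ _⟩
  have hpre : (Γ.boxProd Δ).IsBetween (x, w) (σ⁻¹ corner) (y, w) := by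
    simpa using hcorner.apply (hΓ.boxProd hΔ) (inv_mem hσ)
  have hw : (σ⁻¹ corner).2 = w := hpre.snd_eq hΓ hΔ rfl
  have hσz : σ ((σ⁻¹ corner).1, w) = corner :=
    Equiv.Perm.eq_inv_iff_eq.1 (Prod.ext rfl hw.symm)
  exact ⟨(σ⁻¹ corner).1, (Prod.ext_iff.1 hσz).1, (Prod.ext_iff.1 hσz).2⟩

theorem isFactorization_of_mem_aut (hΓ : Γ.IsWeaklyConnected) (hΔ : Δ.IsWeaklyConnected)
    (hσ : σ ∈ (Γ.boxProd Δ).aut) (w : W) :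
    Γ.IsFactorization (Setoid.ker fun v => (σ (v, w)).1) (Setoid.ker fun v => (σ (v, w)).2) := by
  have hadj (u v : V) : Γ.Adj u v ↔ (Γ.boxProd Δ).Adj (σ (u, w)) (σ (v, w)) := by
    rw [mem_aut.1 hσ, boxProd_adj_mk_right]
  refine ⟨fun hfst hsnd => congrArg Prod.fst (σ.injective (Prod.ext hfst hsnd)),
    fun x y => ?_, fun h => ?_, fun hx hy h h' => ?_, fun hx hy h h' => ?_⟩
  · obtain ⟨z, hfst, hsnd⟩ := exists_corner_of_mem_aut hΓ hΔ hσ w x y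
    exact ⟨z, hfst.symm, hsnd⟩
  · exact (boxProd_adj.1 ((hadj _ _).1 h)).imp And.left And.left
  · rw [hadj, hadj, boxProd_adj_of_snd_eq h, boxProd_adj_of_snd_eq h', Setoid.ker_def.1 hx,
      Setoid.ker_def.1 hy]
  · rw [hadj, hadj, boxProd_adj_of_fst_eq h, boxProd_adj_of_fst_eq h', Setoid.ker_def.1 hx,
      Setoid.ker_def.1 hy]

theorem exists_mem_aut_of_fst_eq {v₀ : V} (hσ : σ ∈ (Γ.boxProd Δ).aut)
    (hfst : ∀ x, (σ (v₀, x)).1 = v₀) (hfst_inv : ∀ x, (σ⁻¹ (v₀, x)).1 = v₀) :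
    ∃ b ∈ Δ.aut, ∀ x, σ (v₀, x) = (v₀, b x) := by
  have hσx (x : W) : (v₀, (σ (v₀, x)).2) = σ (v₀, x) := Prod.ext (hfst x).symm rfl
  have hσx_inv (x : W) : (v₀, (σ⁻¹ (v₀, x)).2) = σ⁻¹ (v₀, x) := Prod.ext (hfst_inv x).symm rfl
  let b : Equiv.Perm W :=
    { toFun := fun x => (σ (v₀, x)).2
      invFun := fun x => (σ⁻¹ (v₀, x)).2
      left_inv := fun x => by simp [hσx]
      right_inv := fun x =>
        congrArg Prod.snd ((congrArg σ (hσx_inv x)).trans (σ.apply_symm_apply _)) }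
  refine ⟨b, fun x y => ?_, fun x => (hσx x).symm⟩
  have h := hσ (v₀, x) (v₀, y)
  rwa [boxProd_adj_mk_left, boxProd_adj_of_fst_eq ((hfst x).trans (hfst y).symm)] at h

theorem fst_apply_eq_of_layer (hΓ : Γ.IsWeaklyConnected) (hΔ : Δ.IsWeaklyConnected)
    (hσ : σ ∈ (Γ.boxProd Δ).aut) {v₀ : V} {w : W} (hw : ∀ v, (σ (v, w)).1 = v₀)
    {u : V} {x : W} (hu : (σ (u, x)).1 = v₀) (u' : V) : (σ (u', x)).1 = v₀ := by
  have hbetween : (Γ.boxProd Δ).IsBetween (u, x) (u', x) (u', w) :=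
    (isBetween_boxProd hΓ hΔ).2 ⟨isBetween_right _ _ _, isBetween_left _ _ _⟩
  exact ((hbetween.apply (hΓ.boxProd hΔ) hσ).fst_eq hΓ hΔ (hu.trans (hw u').symm)).trans (hw u')

/-- Conjugating `a × 1` by `σ` gives an automorphism of the product that preserves the layer
`{v₀} × W`, because the preimage of that layer under `σ` is a union of layers `V × {x}`. -/
theorem exists_mem_aut_of_layer (hΓ : Γ.IsWeaklyConnected) (hΔ : Δ.IsWeaklyConnected)
    (hσ : σ ∈ (Γ.boxProd Δ).aut) {v₀ : V} {w : W} (hw : ∀ v, (σ (v, w)).1 = v₀)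
    {a : Equiv.Perm V} (ha : a ∈ Γ.aut) : ∃ b ∈ Δ.aut, ∀ v, b (σ (v, w)).2 = (σ (a v, w)).2 := by
  let τ : Equiv.Perm V → Equiv.Perm (V × W) := fun c => σ * permProdHom V W (c, 1) * σ⁻¹
  have hτσ (c : Equiv.Perm V) (p : V × W) : τ c (σ p) = σ (c p.1, p.2) := by
    simp [τ, permProdHom_apply]
  have hτ_inv : (τ a)⁻¹ = τ a⁻¹ := by
    simp only [τ, mul_inv_rev, inv_inv, ← map_inv, Prod.inv_mk, inv_one, mul_assoc]
  have hτ_fst (c : Equiv.Perm V) (x : W) : (τ c (v₀, x)).1 = v₀ := by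
    obtain ⟨p, hp⟩ := σ.surjective (v₀, x)
    rw [← hp, hτσ]
    exact fst_apply_eq_of_layer hΓ hΔ hσ hw (congrArg Prod.fst hp) _
  have hτ_mem : τ a ∈ (Γ.boxProd Δ).aut :=
    mul_mem (mul_mem hσ (permProdHom_mem_aut ha (one_mem _))) (inv_mem hσ)
  obtain ⟨b, hb, hτb⟩ :=
    exists_mem_aut_of_fst_eq hτ_mem (hτ_fst a) (by simpa only [hτ_inv] using hτ_fst a⁻¹)
  refine ⟨b, hb, fun v => ?_⟩
  have hv : σ (v, w) = (v₀, (σ (v, w)).2) := Prod.ext (hw v) rfl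
  rw [← hτσ a (v, w), hv, hτb]

theorem nonempty_stabilizer_embedding (hΓ : Γ.IsWeaklyConnected) (hΔ : Δ.IsWeaklyConnected)
    (hσ : σ ∈ (Γ.boxProd Δ).aut) {v₀ : V} {w : W} (hw : ∀ v, (σ (v, w)).1 = v₀) (v : V) :
    Nonempty (MulAction.stabilizer Γ.aut v ↪ MulAction.stabilizer Δ.aut (σ (v, w)).2) := by
  choose b hb_mem hb using fun a : Γ.aut => exists_mem_aut_of_layer hΓ hΔ hσ hw a.2
  have hfix (a : MulAction.stabilizer Γ.aut v) : b a (σ (v, w)).2 = (σ (v, w)).2 := by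
    rw [hb, show (a : Γ.aut).1 v = v from a.2]
  refine ⟨fun a => ⟨⟨b a, hb_mem a⟩, hfix a⟩, fun a a' h => ?_⟩
  have hbb : b a = b a' := congrArg (fun c => c.1.1) h
  refine Subtype.ext (Subtype.ext (Equiv.ext fun u => ?_))
  have hsnd : (σ ((a : Γ.aut).1 u, w)).2 = (σ ((a' : Γ.aut).1 u, w)).2 := by
    rw [← hb, ← hb, hbb]
  exact congrArg Prod.fst (σ.injective (Prod.ext ((hw _).trans (hw _).symm) hsnd))

theorem snd_apply_eq_of_isIndecomposable (hΓ : Γ.IsWeaklyConnected) (hi : Γ.IsIndecomposable)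
    (hΔ : Δ.IsWeaklyConnected)
    (hstab : ∀ (v : V) (w : W),
      IsEmpty (MulAction.stabilizer Γ.aut v ↪ MulAction.stabilizer Δ.aut w))
    (hσ : σ ∈ (Γ.boxProd Δ).aut) {p q : V × W} (h : p.2 = q.2) : (σ p).2 = (σ q).2 := by
  obtain ⟨v, w⟩ := p
  obtain ⟨v', w⟩ := q
  obtain rfl : _ = w := h
  rcases hi _ _ (isFactorization_of_mem_aut hΓ hΔ hσ _) with hfst | hsnd
  · obtain ⟨f⟩ := nonempty_stabilizer_embedding hΓ hΔ hσ
      (fun u => Setoid.eq_top_iff.1 hfst u v) v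
    exact (hstab _ _).elim f
  · exact Setoid.eq_top_iff.1 hsnd v v'

theorem fst_apply_eq_of_snd_iff (hΔ : Δ.IsWeaklyConnected) (hσ : σ ∈ (Γ.boxProd Δ).aut)
    (hsnd : ∀ p q, (σ p).2 = (σ q).2 ↔ p.2 = q.2) {p q : V × W} (h : p.1 = q.1) :
    (σ p).1 = (σ q).1 := by
  have hadj (v : V) {x y : W} (hxy : Δ.Adj x y) : (σ (v, x)).1 = (σ (v, y)).1 := by
    have hσxy := (mem_aut.1 hσ (v, x) (v, y)).2 (boxProd_adj_mk_left.2 hxy)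
    rcases boxProd_adj.1 hσxy with hfst | hsnd'
    · exact hfst.1
    · exact absurd ((hsnd _ _).1 hsnd'.1) (ne_of_adj hxy)
  obtain ⟨v, x⟩ := p
  obtain ⟨v', y⟩ := q
  obtain rfl : v = v' := h
  obtain ⟨walk⟩ := hΔ.preconnected x y
  induction walk with
  | nil => rfl
  | cons hxy _ ih =>
    refine Eq.trans ?_ ih
    exact ((SimpleGraph.fromRel_adj _ _ _).1 hxy).2.elim (hadj v) fun hyx => (hadj v hyx).symm

theorem aut_boxProd_eq (hΓ : Γ.IsWeaklyConnected) (hi : Γ.IsIndecomposable)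
    (hΔ : Δ.IsWeaklyConnected)
    (hstab : ∀ (v : V) (w : W),
      IsEmpty (MulAction.stabilizer Γ.aut v ↪ MulAction.stabilizer Δ.aut w)) :
    (Γ.boxProd Δ).aut = permGroupProd Γ.aut Δ.aut := by
  have : Nonempty V := hΓ.nonempty
  have : Nonempty W := hΔ.nonempty
  have hsnd : ∀ σ ∈ (Γ.boxProd Δ).aut, ∀ p q, (σ p).2 = (σ q).2 ↔ p.2 = q.2 := by
    refine fun σ hσ p q => ⟨fun h => ?_, snd_apply_eq_of_isIndecomposable hΓ hi hΔ hstab hσ⟩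
    simpa using snd_apply_eq_of_isIndecomposable hΓ hi hΔ hstab (inv_mem hσ) h
  have hfst : ∀ σ ∈ (Γ.boxProd Δ).aut, ∀ p q, (σ p).1 = (σ q).1 ↔ p.1 = q.1 := by
    refine fun σ hσ p q => ⟨fun h => ?_, fst_apply_eq_of_snd_iff hΔ hσ (hsnd σ hσ)⟩
    simpa using fst_apply_eq_of_snd_iff hΔ (inv_mem hσ) (hsnd _ (inv_mem hσ)) h
  exact le_antisymm (fun σ hσ => mem_permGroupProd_of_mem_aut hσ (hfst σ hσ) (hsnd σ hσ))
    (permGroupProd_aut_le Γ Δ)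

end AutBoxProd

end LooplessDigraph

section Cayley

variable {G H : Type*} [Group G] [Group H]

theorem mem_rightRegular {σ : Equiv.Perm G} : σ ∈ rightRegular G ↔ ∃ g : G, ∀ x, σ x = x * g := by
  constructor
  · rintro ⟨g, rfl⟩
    exact ⟨g.unop, fun x => rfl⟩
  · rintro ⟨g, hg⟩
    exact ⟨MulOpposite.op g, Equiv.ext fun x => (hg x).symm⟩

theorem rightRegular_prod :
    rightRegular (G × H) = permGroupProd (rightRegular G) (rightRegular H) := by
  ext σ
  rw [mem_rightRegular]
  constructor
  · rintro ⟨g, hg⟩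
    exact ⟨Equiv.mulRight g.1, mem_rightRegular.2 ⟨g.1, fun _ => rfl⟩,
      Equiv.mulRight g.2, mem_rightRegular.2 ⟨g.2, fun _ => rfl⟩, fun u v => hg (u, v)⟩
  · rintro ⟨a, ha, b, hb, hσ⟩
    obtain ⟨g, hg⟩ := mem_rightRegular.1 ha
    obtain ⟨k, hk⟩ := mem_rightRegular.1 hb
    exact ⟨(g, k), fun x => (hσ x.1 x.2).trans (Prod.ext (hg x.1) (hk x.2))⟩

namespace LooplessDigraph

variable {Γ : LooplessDigraph G} {Δ : LooplessDigraph H}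

theorem isCayley_iff_rightRegular_le : Γ.IsCayley ↔ rightRegular G ≤ Γ.aut := by
  constructor
  · rintro ⟨S, hS, rfl⟩ σ hσ u v
    obtain ⟨g, hg⟩ := mem_rightRegular.1 hσ
    simp [cayley, hg, mul_assoc]
  · intro h
    refine ⟨{g | Γ.Adj 1 g}, Γ.loopless 1, ?_⟩
    have hadj (u v : G) : Γ.Adj u v ↔ Γ.Adj 1 (v * u⁻¹) := by
      simpa using (h (mem_rightRegular.2 ⟨u⁻¹, fun _ => rfl⟩ : Equiv.mulRight u⁻¹ ∈ _) u v).symm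
    obtain ⟨⟨Adj⟩, hloop⟩ := Γ
    simp only [cayley, mk.injEq, Digraph.mk.injEq]
    ext u v
    exact hadj u v

theorem IsCayley.boxProd (hΓ : Γ.IsCayley) (hΔ : Δ.IsCayley) : (Γ.boxProd Δ).IsCayley := by
  rw [isCayley_iff_rightRegular_le] at hΓ hΔ ⊢
  rw [rightRegular_prod]
  exact (permGroupProd_mono hΓ hΔ).trans (permGroupProd_aut_le Γ Δ)

theorem cayleyIndex_boxProd (h : (Γ.boxProd Δ).aut = permGroupProd Γ.aut Δ.aut) :
    (Γ.boxProd Δ).cayleyIndex = Γ.cayleyIndex * Δ.cayleyIndex := by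
  rw [cayleyIndex, h, rightRegular_prod, relIndex_permGroupProd, cayleyIndex, cayleyIndex]

theorem IsCayley.card_stabilizer (h : Γ.IsCayley) (x : G) :
    Nat.card (MulAction.stabilizer Γ.aut x) = Γ.cayleyIndex := by
  have hcompl : ((rightRegular G).subgroupOf Γ.aut).IsComplement'
      (MulAction.stabilizer Γ.aut x) := by
    refine Subgroup.isComplement'_stabilizer x ?_ fun σ => ?_
    · rintro ⟨σ, hσ⟩ hx
      obtain ⟨g, hg⟩ := mem_rightRegular.1 hσ
      have hg_one : g = 1 := mul_eq_left.1 ((hg x).symm.trans hx)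
      exact Subtype.ext (Subtype.ext (Equiv.ext fun y => by simpa [hg_one] using hg y))
    · have hmem : Equiv.mulRight ((σ • x)⁻¹ * x) ∈ rightRegular G :=
        mem_rightRegular.2 ⟨_, fun _ => rfl⟩
      exact ⟨⟨⟨_, isCayley_iff_rightRegular_le.1 h hmem⟩, hmem⟩, mul_inv_cancel_left _ _⟩
  exact hcompl.symm.index_eq_card.symm

theorem cayleyIndex_ne_zero [Finite G] (Γ : LooplessDigraph G) : Γ.cayleyIndex ≠ 0 :=
  Subgroup.index_ne_zero_of_finite (H := (rightRegular G).subgroupOf Γ.aut)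

theorem IsCayley.isEmpty_stabilizer_embedding (hΓ : Γ.IsCayley) (hΔ : Δ.IsCayley)
    (hΔ_ne : Δ.cayleyIndex ≠ 0) (hlt : Δ.cayleyIndex < Γ.cayleyIndex) (x : G) (y : H) :
    IsEmpty (MulAction.stabilizer Γ.aut x ↪ MulAction.stabilizer Δ.aut y) := by
  rw [← hΔ.card_stabilizer y] at hΔ_ne hlt
  rw [← hΓ.card_stabilizer x] at hlt
  have : Finite (MulAction.stabilizer Δ.aut y) := Nat.finite_of_card_ne_zero hΔ_ne
  exact ⟨fun f => hlt.not_ge (Nat.card_le_card_of_injective f f.injective)⟩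

end LooplessDigraph

end Cayley

-- A Cayley index of `0` means that the index is infinite.
theorem corollary2p5_general {G H : Type*} [Group G] [Group H]
    (Γ₁ : LooplessDigraph G) (Γ₂ : LooplessDigraph H) (i₁ i₂ : ℕ)
    (hΓ₁ : Γ₁.IsCayley) (hproper : Γ₁.IsProper) (hi₁ : Γ₁.cayleyIndex = i₁)
    (hΓ₂ : Γ₂.IsCayley) (hconn : Γ₂.IsWeaklyConnected) (hi₂ : Γ₂.cayleyIndex = i₂)
    (hi₂_ne : i₂ ≠ 0) (hlt : i₂ < i₁) :
    ∃ Δ : LooplessDigraph G, (Δ = Γ₁ ∨ Δ = Γ₁.complement) ∧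
      (Δ.boxProd Γ₂).aut = permGroupProd Γ₁.aut Γ₂.aut ∧
      (Δ.boxProd Γ₂).IsCayley ∧
      (Δ.boxProd Γ₂).IsProper ∧
      (Δ.boxProd Γ₂).cayleyIndex = i₁ * i₂ := by
  subst hi₁ hi₂
  obtain ⟨Δ, hΔ, hΔ_conn, hΔ_indec⟩ := hproper.exists_isWeaklyConnected_isIndecomposable
  obtain ⟨haut, hΔ_proper⟩ : Δ.aut = Γ₁.aut ∧ Δ.IsProper := by
    rcases hΔ with rfl | rfl
    · exact ⟨rfl, hproper⟩
    · exact ⟨Γ₁.aut_complement, hproper.complement⟩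
  have hindex : Δ.cayleyIndex = Γ₁.cayleyIndex := congrArg (rightRegular G).relIndex haut
  have hΔ_cayley : Δ.IsCayley := by
    rwa [LooplessDigraph.isCayley_iff_rightRegular_le, haut,
      ← LooplessDigraph.isCayley_iff_rightRegular_le]
  have hprod : (Δ.boxProd Γ₂).aut = permGroupProd Δ.aut Γ₂.aut :=
    LooplessDigraph.aut_boxProd_eq hΔ_conn hΔ_indec hconn
      (hΔ_cayley.isEmpty_stabilizer_embedding hΓ₂ hi₂_ne (hindex ▸ hlt))
  exact ⟨Δ, hΔ, haut ▸ hprod, hΔ_cayley.boxProd hΓ₂, hΔ_proper.boxProd Γ₂,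
    hindex ▸ LooplessDigraph.cayleyIndex_boxProd hprod⟩

theorem corollary2p5 {G H : Type*} [Group G] [Finite G] [Group H] [Finite H]
    (Γ₁ : LooplessDigraph G) (Γ₂ : LooplessDigraph H) (i₁ i₂ : ℕ)
    (hΓ₁ : Γ₁.IsCayley) (hproper : Γ₁.IsProper) (hi₁ : Γ₁.cayleyIndex = i₁)
    (hΓ₂ : Γ₂.IsCayley) (hconn : Γ₂.IsWeaklyConnected) (hi₂ : Γ₂.cayleyIndex = i₂)
    (hlt : i₂ < i₁) :
    ∃ Δ : LooplessDigraph G, (Δ = Γ₁ ∨ Δ = Γ₁.complement) ∧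
      (Δ.boxProd Γ₂).aut = permGroupProd Γ₁.aut Γ₂.aut ∧
      (Δ.boxProd Γ₂).IsCayley ∧
      (Δ.boxProd Γ₂).IsProper ∧
      (Δ.boxProd Γ₂).cayleyIndex = i₁ * i₂ := by
  exact corollary2p5_general Γ₁ Γ₂ i₁ i₂ hΓ₁ hproper hi₁ hΓ₂ hconn hi₂
    (hi₂ ▸ Γ₂.cayleyIndex_ne_zero) hlt
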